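/- Let $n\ge 1$, let $K\in\mathbb{R}^{n\times n}$ be a kernel Gram matrix (equivalently, a symmetric positive semidefinite matrix), and let $K/n=UDU^\top$ be an eigendecomposition with $U$ orthogonal, $D=\operatorname{diag}(\mu_1,\dots,\mu_n)$ and $\mu_1\ge\dots\ge\mu_n$. Let $\delta_n^2$ be the critical radius of $K/n$, i.e. the lowest $\delta^2>0$ such that $\big(\frac1n\sum_{i=1}^n\min(\delta^2,\mu_i)\big)^{1/2}\le\delta^2$ (with $\delta_n^2=0$ if $K=0$), and let $\delta_n=\sqrt{\delta_n^2}$. Let $d_n=\min\{j\in\{1,\dots,n\}:\mu_j\le\delta_n^2\}$, with $d_n=n$ if no such $j$ exists. Write $U_1\in\mathbb{R}^{n\times d_n}$ for the first $d_n$ columns of $U$, $U_2\in\mathbb{R}^{n\times(n-d_n)}$ for the remaining ones, and $D_2=\operatorname{diag}(\mu_{d_n+1},\dots,\mu_n)$. A matrix $S\in\mathbb{R}^{s\times n}$ is called $K$-satisfiable for $c>0$ if $$\big\|(SU_1)^\top SU_1-I_{d_n}\big\|_{\mathrm{op}}\le\tfrac12\qquad\text{and}\qquad\big\|SU_2D_2^{1/2}\big\|_{\mathrm{op}}\le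 c\,\delta_n .$$ For $p\in(0,1]$, a $p$-sparsified sketch is a random matrix $S\in\mathbb{R}^{s\times n}$ with i.i.d. entries which either (Rademacher case) equal $\pm\frac1{\sqrt{sp}}$ with probability $\frac p2$ each and $0$ with probability $1-p$, or (Gaussian case) equal $\frac1{\sqrt{sp}}G$, with $G$ a standard normal variable, with probability $p$ and $0$ with probability $1-p$. Theorem. There are universal constants $C_0,C_1>0$ and, for $p\in(0,1]$, a constant $c(p)>0$ depending only on $p$ and strictly increasing in $p$, such that for all $n$, $s$, $p\in(0,1]$, all $K$ and $U,D$ as above, and every $p$-sparsified (Rademacher or Gaussian) sketch $S\in\mathbb{R}^{s\times n}$: if $$s\ge\max\Big(\frac{C_0\,d_n}{p^2},\;\delta_n^2\,n\Big),$$ then $S$ is $K$-satisfiable for $c=\frac{2}{\sqrt p}\big(1+\sqrt{\log 5}\big)+1$ with probability at least $1-C_1e^{-s\,c(p)}$. -/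

import Mathlib

open MeasureTheory ProbabilityTheory

noncomputable section

namespace Sketch

/-- `K / n = U D Uᵀ` with `U` orthogonal and `D = diag(μ)`, the eigenvalues `μ` being listed in
decreasing order. -/
structure IsEigendecomposition {n : ℕ} (K U : Matrix (Fin n) (Fin n) ℝ) (μ : Fin n → ℝ) :
    Prop where
  orthogonal : U ∈ Matrix.orthogonalGroup (Fin n) ℝ
  antitone : Antitone μ
  eq : (1 / (n : ℝ)) • K = U * Matrix.diagonal μ * U.transpose

/-- The kernel complexity `ψ`, as a function of `t = δ²`:
`ψ(δ) = ((1 / n) ∑ᵢ min(δ², μᵢ)) ^ (1 / 2)`. -/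
def kernelComplexity {n : ℕ} (μ : Fin n → ℝ) (t : ℝ) : ℝ :=
  Real.sqrt ((1 / (n : ℝ)) * ∑ i, min t (μ i))

/-- The (squared) critical radius `δₙ²`: the lowest positive `t = δ²` with `ψ(δ) ≤ δ²`.
Positivity of `t` is required because `t = 0` always satisfies the inequality. (The infimum is a
minimum unless `μ = 0`, in which case it is `0`.) -/
def criticalRadiusSq {n : ℕ} (μ : Fin n → ℝ) : ℝ :=
  sInf {t : ℝ | 0 < t ∧ kernelComplexity μ t ≤ t}

/-- The critical radius `δₙ`. -/
def criticalRadius {n : ℕ} (μ : Fin n → ℝ) : ℝ :=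
  Real.sqrt (criticalRadiusSq μ)

open scoped Classical in
/-- The statistical dimension `dₙ = min {j ∈ {1, …, n} : μⱼ ≤ δₙ²}`, and `dₙ = n` if there is no
such `j`. The element `j : Fin n` stands for the 1-based index `j + 1`. -/
def statDim {n : ℕ} (μ : Fin n → ℝ) : ℕ :=
  if ∃ j : Fin n, μ j ≤ criticalRadiusSq μ then
    sInf {m : ℕ | ∃ j : Fin n, m = (j : ℕ) + 1 ∧ μ j ≤ criticalRadiusSq μ}
  else n

/-- `U₁`: the first `dₙ` columns of `U`. -/
def leftBlock {n : ℕ} (U : Matrix (Fin n) (Fin n) ℝ) (μ : Fin n → ℝ) :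
    Matrix (Fin n) {j : Fin n // (j : ℕ) < statDim μ} ℝ :=
  U.submatrix id Subtype.val

/-- `U₂`: the last `n - dₙ` columns of `U`. -/
def rightBlock {n : ℕ} (U : Matrix (Fin n) (Fin n) ℝ) (μ : Fin n → ℝ) :
    Matrix (Fin n) {j : Fin n // statDim μ ≤ (j : ℕ)} ℝ :=
  U.submatrix id Subtype.val

/-- `D₂ ^ (1 / 2)`, where `D₂ = diag(μ_{dₙ + 1}, …, μₙ)`. -/
def sqrtTail {n : ℕ} (μ : Fin n → ℝ) :
    Matrix {j : Fin n // statDim μ ≤ (j : ℕ)} {j : Fin n // statDim μ ≤ (j : ℕ)} ℝ :=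
  Matrix.diagonal fun j => Real.sqrt (μ j)

open scoped Matrix.Norms.L2Operator in
/-- `S` is `K`-satisfiable for the constant `c`, where `K / n = U diag(μ) Uᵀ`. The norms are
operator norms with respect to the Euclidean norms. -/
def KSatisfiable {s n : ℕ} (U : Matrix (Fin n) (Fin n) ℝ) (μ : Fin n → ℝ)
    (S : Matrix (Fin s) (Fin n) ℝ) (c : ℝ) : Prop :=
  ‖(S * leftBlock U μ).transpose * (S * leftBlock U μ) - 1‖ ≤ 1 / 2 ∧
    ‖S * rightBlock U μ * sqrtTail μ‖ ≤ c * criticalRadius μ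

/-- Law of an entry of a `p`-sparsified Rademacher sketch with `s` rows: `± 1 / √(s p)` with
probability `p / 2` each, and `0` with probability `1 - p`. -/
def rademacherEntryLaw (s : ℕ) (p : ℝ) : Measure ℝ :=
  ENNReal.ofReal (p / 2) • Measure.dirac (1 / Real.sqrt (s * p)) +
    ENNReal.ofReal (1 - p) • Measure.dirac 0 +
    ENNReal.ofReal (p / 2) • Measure.dirac (-1 / Real.sqrt (s * p))

/-- Law of an entry of a `p`-sparsified Gaussian sketch with `s` rows: `G / √(s p)` with `G` a
standard normal variable, with probability `p`, and `0` with probability `1 - p`. -/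
def gaussianEntryLaw (s : ℕ) (p : ℝ) : Measure ℝ :=
  ENNReal.ofReal p • (gaussianReal 0 1).map (fun x => 1 / Real.sqrt (s * p) * x) +
    ENNReal.ofReal (1 - p) • Measure.dirac 0

/-- The entries of the random matrix `S` are i.i.d. with law `ν`. -/
structure HasIIDEntries {Ω : Type*} [MeasurableSpace Ω] (P : Measure Ω) {s n : ℕ}
    (S : Ω → Matrix (Fin s) (Fin n) ℝ) (ν : Measure ℝ) : Prop where
  hasLaw : ∀ i j, HasLaw (fun ω => S ω i j) ν P
  indep : iIndepFun (fun (ij : Fin s × Fin n) ω => S ω ij.1 ij.2) P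

/-- `S` is a `p`-sparsified (Rademacher or Gaussian) sketch. -/
def IsSparsifiedSketch {Ω : Type*} [MeasurableSpace Ω] (P : Measure Ω) {s n : ℕ} (p : ℝ)
    (S : Ω → Matrix (Fin s) (Fin n) ℝ) : Prop :=
  HasIIDEntries P S (rademacherEntryLaw s p) ∨ HasIIDEntries P S (gaussianEntryLaw s p)

end Sketch

end

/-! Only three features of the entries matter: both laws are centred, have variance `1 / s`, and are
sub-Gaussian with variance proxy `1 / (s p)`. Each half of `K`-satisfiability then follows from an
exponential moment bound for one fixed unit vector and a union bound over a `1/4`-net of a sphere,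
with at most `9 ^ d` points in dimension `d`.

Near isometry on the top eigenspace: for a unit vector `w` in the range of `U₁`, `‖S w‖ ^ 2 - 1` is
an average of `s` independent centred squares, so it exceeds `1/4` in absolute value with
probability at most `2 exp(-s p ^ 2 / 18432)` (`HasIIDEntries.measure_sq_sub_one_le`). The net lies
in dimension `dₙ`, and `s ≥ C₀ dₙ / p ^ 2` lets half of this exponent absorb its cardinality.

Tail: here the net is taken in the row space `ℝ ^ s`. For a unit vector `u`, the vector `U₂ᵀ Sᵀ u`
is sub-Gaussian with proxy `1 / (s p)`, because `U₂` has orthonormal columns. Its weighted square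
norm with weights `μⱼ` is handled by Gaussian linearization (`lintegral_exp_sum_mul_sq_le`),
provided the weights are at most `δₙ²` and sum to at most `s δₙ²`. The first bound is the definition
of `dₙ`. For the second, the critical inequality bounds the tail sum by `n δₙ⁴`, and `n δₙ² ≤ s`
(`sum_tail_le`). The resulting exponent beats the `9 ^ s` points of the net. -/

/-! ### Nets of the unit sphere and operator norms -/

open Metric Module in
/-- A finite `1/4`-separated subset of the unit ball has at most `9 ^ d` elements. -/
theorem card_le_nine_pow_of_separated {E : Type*} [NormedAddCommGroup E] [NormedSpace ℝ E]
    [FiniteDimensional ℝ E] (s : Finset E) (hs : ∀ c ∈ s, ‖c‖ ≤ 1)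
    (h : ∀ c ∈ s, ∀ d ∈ s, c ≠ d → 1 / 4 ≤ ‖c - d‖) : s.card ≤ 9 ^ finrank ℝ E := by
  borelize E
  let μ : Measure E := Measure.addHaar
  set A := ⋃ c ∈ s, ball (c : E) (1 / 8) with hA
  have D : Set.Pairwise (s : Set E) (Function.onFun Disjoint fun c => ball (c : E) (1 / 8)) := by
    rintro c hc d hd hcd
    apply ball_disjoint_ball
    rw [dist_eq_norm]
    linarith [h c hc d hd hcd]
  have A_subset : A ⊆ ball (0 : E) (9 / 8) := by
    refine Set.iUnion₂_subset fun x hx => ball_subset_ball' ?_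
    rw [dist_zero_right]
    linarith [hs x hx]
  -- Volume comparison: disjoint balls of radius `1/8` inside a ball of radius `9/8`, whence the
  -- ratio `9` per dimension.
  have I : (s.card : ENNReal) * ENNReal.ofReal ((1 / 8) ^ finrank ℝ E) * μ (ball 0 1) ≤
      ENNReal.ofReal ((9 / 8) ^ finrank ℝ E) * μ (ball 0 1) := by
    calc
      _ = μ A := by
        rw [hA, measure_biUnion_finset D fun c _ => measurableSet_ball]
        simp only [μ.addHaar_ball_of_pos _ (show (0 : ℝ) < 1 / 8 by norm_num), Finset.sum_const,
          nsmul_eq_mul, mul_assoc]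
      _ ≤ μ (ball (0 : E) (9 / 8)) := measure_mono A_subset
      _ = _ := by rw [μ.addHaar_ball_of_pos _ (by norm_num)]
  have J := (ENNReal.mul_le_mul_iff_left (measure_ball_pos μ _ zero_lt_one).ne'
    measure_ball_lt_top.ne).1 I
  have K := ENNReal.toReal_le_of_le_ofReal (by positivity) J
  rw [ENNReal.toReal_mul, ENNReal.toReal_natCast, ENNReal.toReal_ofReal (by positivity),
    div_pow, div_pow, one_pow, mul_one_div] at K
  have := (div_le_div_iff_of_pos_right (by positivity)).1 K
  exact_mod_cast this

/-- The unit sphere of a `d`-dimensional space has a `1/4`-net of at most `9 ^ d` points. -/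
theorem exists_sphere_net (E : Type*) [NormedAddCommGroup E] [NormedSpace ℝ E]
    [FiniteDimensional ℝ E] :
    ∃ N : Finset E, N.card ≤ 9 ^ Module.finrank ℝ E ∧ (∀ y ∈ N, ‖y‖ = 1) ∧
      ∀ x : E, ‖x‖ = 1 → ∃ y ∈ N, ‖x - y‖ ≤ 1 / 4 := by
  classical
  let Q : Finset E → Prop := fun s => (∀ c ∈ s, ‖c‖ = 1) ∧
    ∀ c ∈ s, ∀ d ∈ s, c ≠ d → 1 / 4 ≤ ‖c - d‖
  have hcard : ∀ s, Q s → s.card ≤ 9 ^ Module.finrank ℝ E := fun s hs =>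
    card_le_nine_pow_of_separated s (fun c hc => (hs.1 c hc).le) hs.2
  -- A separated subset of the sphere of maximal cardinality is a net: a point far from all its
  -- elements could be added to it.
  obtain ⟨m, ⟨N, hN, rfl⟩, hmax⟩ : ∃ m, (∃ s, Q s ∧ s.card = m) ∧
      ∀ s, Q s → s.card ≤ m := by
    let T : Set ℕ := {m | ∃ s, Q s ∧ s.card = m}
    have hT : BddAbove T := ⟨_, by rintro _ ⟨s, hs, rfl⟩; exact hcard s hs⟩
    have hne : T.Nonempty := ⟨0, ∅, by simp [Q], rfl⟩
    exact ⟨sSup T, Nat.sSup_mem hne hT, fun s hs => le_csSup hT ⟨s, hs, rfl⟩⟩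
  refine ⟨N, hcard N hN, hN.1, fun x hx => ?_⟩
  by_contra! hfar
  have hxN : x ∉ N := fun hxN => by
    have := hfar x hxN
    norm_num at this
  have hQ : Q (insert x N) := by
    refine ⟨fun c hc => ?_, fun c hc d hd hcd => ?_⟩
    · rcases Finset.mem_insert.1 hc with rfl | hc
      · exact hx
      · exact hN.1 c hc
    · rcases Finset.mem_insert.1 hc with rfl | hc' <;>
        rcases Finset.mem_insert.1 hd with rfl | hd'
      · exact absurd rfl hcd
      · exact (hfar d hd').le
      · rw [norm_sub_rev]; exact (hfar c hc').le
      · exact hN.2 c hc' d hd' hcd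
  have := hmax _ hQ
  rw [Finset.card_insert_of_notMem hxN] at this
  omega

/-- Bound of an operator norm through a `1/4`-net of the sphere. -/
theorem ContinuousLinearMap.opNorm_le_of_net {E F : Type*} [NormedAddCommGroup E]
    [NormedSpace ℝ E] [NormedAddCommGroup F] [NormedSpace ℝ F] (T : E →L[ℝ] F) {N : Finset E}
    (hN : ∀ x : E, ‖x‖ = 1 → ∃ y ∈ N, ‖x - y‖ ≤ 1 / 4) {a : ℝ} (ha : 0 ≤ a)
    (h : ∀ y ∈ N, ‖T y‖ ≤ a) : ‖T‖ ≤ 4 / 3 * a := by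
  -- The error made by moving to the net is a fraction of `‖T‖` itself and is absorbed on the left;
  -- since `‖T‖` is finite this gives the factor `4 / 3`.
  have : ‖T‖ ≤ a + 1 / 4 * ‖T‖ := by
    refine T.opNorm_le_of_unit_norm (by positivity) fun x hx => ?_
    obtain ⟨y, hy, hxy⟩ := hN x hx
    calc ‖T x‖ = ‖T y + T (x - y)‖ := by rw [← map_add]; congr 2; abel
      _ ≤ ‖T y‖ + ‖T (x - y)‖ := norm_add_le _ _
      _ ≤ a + ‖T‖ * (1 / 4) :=
        add_le_add (h y hy) ((T.le_opNorm _).trans (by gcongr))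
      _ = _ := by ring
  linarith

/-- Bound of the norm of a self-adjoint operator through a `1/4`-net of the sphere. -/
theorem ContinuousLinearMap.opNorm_le_of_isSymmetric_of_net {E : Type*} [NormedAddCommGroup E]
    [InnerProductSpace ℝ E] (T : E →L[ℝ] E) (hT : T.IsSymmetric) {N : Finset E}
    (hN1 : ∀ y ∈ N, ‖y‖ = 1) (hN : ∀ x : E, ‖x‖ = 1 → ∃ y ∈ N, ‖x - y‖ ≤ 1 / 4) {a : ℝ}
    (ha : 0 ≤ a) (h : ∀ y ∈ N, |inner ℝ (T y) y| ≤ a) : ‖T‖ ≤ 2 * a := by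
  -- Moving `x` to the net changes each of the two slots of the quadratic form by at most `‖T‖ / 4`.
  -- Symmetry then makes `‖T‖` the supremum of the Rayleigh quotients.
  have hq : ∀ x : E, ‖x‖ = 1 → |inner ℝ (T x) x| ≤ a + 1 / 2 * ‖T‖ := fun x hx => by
    obtain ⟨y, hy, hxy⟩ := hN x hx
    have e : inner ℝ (T x) x =
        inner ℝ (T y) y + (inner ℝ (T (x - y)) x + inner ℝ (T y) (x - y)) := by
      simp only [map_sub, inner_sub_left, inner_sub_right]
      ring
    have h1 : |inner ℝ (T (x - y)) x| ≤ 1 / 4 * ‖T‖ := by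
      refine (abs_real_inner_le_norm _ _).trans ?_
      rw [hx, mul_one, mul_comm]
      exact (T.le_opNorm _).trans (by gcongr)
    have h2 : |inner ℝ (T y) (x - y)| ≤ 1 / 4 * ‖T‖ := by
      refine (abs_real_inner_le_norm _ _).trans ?_
      have := T.le_opNorm y
      rw [hN1 y hy, mul_one] at this
      rw [mul_comm]
      gcongr
    rw [e]
    linarith [abs_add_le (inner ℝ (T y) y) (inner ℝ (T (x - y)) x + inner ℝ (T y) (x - y)),
      abs_add_le (inner ℝ (T (x - y)) x) (inner ℝ (T y) (x - y)), h y hy]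
  have : ‖T‖ ≤ a + 1 / 2 * ‖T‖ := by
    conv_lhs => rw [T.norm_eq_iSup_rayleighQuotient hT]
    refine ciSup_le fun x => ?_
    by_cases hx : x = 0
    · simp [hx]; positivity
    · have hx' : ‖x‖ ≠ 0 := norm_ne_zero_iff.2 hx
      have := hq (‖x‖⁻¹ • x) (by rw [norm_smul, norm_inv, norm_norm, inv_mul_cancel₀ hx'])
      rw [map_smul, inner_smul_left, inner_smul_right] at this
      rw [conj_trivial] at this
      have e : T.rayleighQuotient x = ‖x‖⁻¹ * (‖x‖⁻¹ * inner ℝ (T x) x) := by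
        rw [ContinuousLinearMap.rayleighQuotient, ContinuousLinearMap.reApplyInnerSelf_apply,
          RCLike.re_to_real]
        field_simp
      rwa [e]
  linarith

/-! ### Exponential moments of squares of sub-Gaussian variables -/

/-- Exponential moment of the square of a standard normal variable. -/
theorem lintegral_exp_mul_sq_gaussianReal_le {a : ℝ} (ha0 : 0 ≤ a) (ha : a ≤ 1 / 3) :
    ∫⁻ g, ENNReal.ofReal (Real.exp (a * g ^ 2)) ∂gaussianReal 0 1 ≤
      ENNReal.ofReal (Real.exp (3 * a)) := by
  have hb : 0 < 1 / 2 - a := by linarith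
  rw [gaussianReal_of_var_ne_zero 0 one_ne_zero,
    lintegral_withDensity_eq_lintegral_mul _ (measurable_gaussianPDF 0 1) (by fun_prop)]
  have hfun : (gaussianPDF 0 1 * fun g => ENNReal.ofReal (Real.exp (a * g ^ 2))) =
      fun g => ENNReal.ofReal ((Real.sqrt (2 * Real.pi))⁻¹ *
        Real.exp (-(1 / 2 - a) * g ^ 2)) := by
    ext g
    rw [Pi.mul_apply, gaussianPDF, ← ENNReal.ofReal_mul (gaussianPDFReal_nonneg _ _ _),
      gaussianPDFReal, mul_assoc, ← Real.exp_add]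
    simp only [NNReal.coe_one, mul_one, sub_zero]
    congr 3
    ring
  rw [hfun, ← ofReal_integral_eq_lintegral_ofReal
    ((integrable_exp_neg_mul_sq hb).const_mul _) (ae_of_all _ fun _ => by positivity),
    integral_const_mul, integral_gaussian]
  refine ENNReal.ofReal_le_ofReal ?_
  rw [← Real.sqrt_inv, ← Real.sqrt_mul (by positivity)]
  refine Real.sqrt_le_iff.2 ⟨by positivity, ?_⟩
  have e : (2 * Real.pi)⁻¹ * (Real.pi / (1 / 2 - a)) = 1 / (1 - 2 * a) := by
    have : 1 - 2 * a ≠ 0 := by linarith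
    field_simp
  -- What remains, after squaring, is `1 / (1 - 2a) ≤ 1 + 6a`, which for `a ≥ 0` follows from `a ≤ 1
  -- / 3`.
  rw [e, ← Real.exp_nat_mul]
  refine le_trans ?_ (Real.add_one_le_exp _)
  rw [div_le_iff₀ (by linarith)]
  push_cast
  nlinarith

/-- Laplace transform of the standard normal law, as a lower Lebesgue integral. -/
theorem lintegral_exp_mul_gaussianReal (t : ℝ) :
    ∫⁻ g, ENNReal.ofReal (Real.exp (t * g)) ∂gaussianReal 0 1 =
      ENNReal.ofReal (Real.exp (t ^ 2 / 2)) := by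
  rw [← ofReal_integral_eq_lintegral_ofReal (integrable_exp_mul_gaussianReal t)
    (ae_of_all _ fun _ => by positivity)]
  have := congrFun (mgf_fun_id_gaussianReal (μ := 0) (v := 1)) t
  rw [mgf] at this
  rw [this]
  simp

/-- A lower Lebesgue integral of a product of functions of the coordinates factors. -/
theorem lintegral_pi_prod {ι : Type*} [Fintype ι] {E : ι → Type*} [∀ i, MeasurableSpace (E i)]
    (ν : (i : ι) → Measure (E i)) [∀ i, IsProbabilityMeasure (ν i)] (f : (i : ι) → E i → ENNReal)
    (hf : ∀ i, Measurable (f i)) :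
    ∫⁻ g, ∏ i, f i (g i) ∂Measure.pi ν = ∏ i, ∫⁻ x, f i x ∂ν i := by
  refine (lintegral_prod_eq_prod_lintegral_of_indepFun Finset.univ
    (fun i (g : (i : ι) → E i) => f i (g i))
    (iIndepFun_pi fun i => (hf i).aemeasurable)
    (fun i => (hf i).comp (measurable_pi_apply i))).trans ?_
  refine Finset.prod_congr rfl fun i _ => ?_
  rw [← (measurePreserving_eval ν i).lintegral_comp (hf i)]

/-- Exponential moments of a diagonal quadratic form in a sub-Gaussian random vector. -/
theorem lintegral_exp_sum_mul_sq_le {Ω ι : Type*} [MeasurableSpace Ω] [Fintype ι]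
    {P : Measure Ω} [SFinite P] {X : ι → Ω → ℝ} (hX : ∀ i, AEMeasurable (X i) P) {σ : ℝ}
    (hσ : 0 ≤ σ)
    (h : ∀ v : ι → ℝ, ∫⁻ ω, ENNReal.ofReal (Real.exp (∑ i, v i * X i ω)) ∂P ≤
      ENNReal.ofReal (Real.exp (σ * (∑ i, v i ^ 2) / 2)))
    {b : ι → ℝ} (hb0 : ∀ i, 0 ≤ b i) (hb : ∀ i, b i * σ ≤ 1 / 3) :
    ∫⁻ ω, ENNReal.ofReal (Real.exp (∑ i, b i * X i ω ^ 2)) ∂P ≤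
      ENNReal.ofReal (Real.exp (3 * σ * ∑ i, b i)) := by
  let γ : Measure (ι → ℝ) := Measure.pi fun _ => gaussianReal 0 1
  -- Linearization: `exp(b x ^ 2)` is the Laplace transform of a standard normal variable at `√(2b)
  -- x`. With auxiliary independent normals the quadratic form becomes linear in `X`, and after
  -- exchanging the integrals the hypothesis on `X` applies for fixed `g`.
  have h1 : ∀ ω, ENNReal.ofReal (Real.exp (∑ i, b i * X i ω ^ 2)) =
      ∫⁻ g, ENNReal.ofReal (Real.exp (∑ i, Real.sqrt (2 * b i) * g i * X i ω)) ∂γ := fun ω => by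
    simp only [Real.exp_sum]
    simp_rw [ENNReal.ofReal_prod_of_nonneg (fun _ _ => (Real.exp_pos _).le)]
    rw [lintegral_pi_prod _
      (fun i x => ENNReal.ofReal (Real.exp (Real.sqrt (2 * b i) * x * X i ω)))
      (fun i => by fun_prop)]
    refine Finset.prod_congr rfl fun i _ => ?_
    have := lintegral_exp_mul_gaussianReal (Real.sqrt (2 * b i) * X i ω)
    simp_rw [mul_right_comm _ _ (X i ω)]
    rw [this, mul_pow, Real.sq_sqrt (mul_nonneg zero_le_two (hb0 i))]
    congr 2
    ring
  simp_rw [h1]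
  rw [lintegral_lintegral_swap (by
    refine (ENNReal.measurable_ofReal.comp Real.measurable_exp).comp_aemeasurable ?_
    refine Finset.aemeasurable_fun_sum _ fun i _ => ?_
    have h2 : AEMeasurable (fun z : Ω × (ι → ℝ) => X i z.1) (P.prod γ) := (hX i).comp_fst
    exact AEMeasurable.mul (by fun_prop) h2)]
  calc _ ≤ ∫⁻ g, ∏ i, ENNReal.ofReal (Real.exp (b i * σ * g i ^ 2)) ∂γ := by
        refine lintegral_mono fun g => (h fun i => Real.sqrt (2 * b i) * g i).trans_eq ?_
        rw [← ENNReal.ofReal_prod_of_nonneg (fun _ _ => (Real.exp_pos _).le), ← Real.exp_sum,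
          Finset.mul_sum, Finset.sum_div]
        congr 2
        refine Finset.sum_congr rfl fun i _ => ?_
        rw [mul_pow, Real.sq_sqrt (mul_nonneg zero_le_two (hb0 i))]
        ring
    _ = ∏ i, ∫⁻ x, ENNReal.ofReal (Real.exp (b i * σ * x ^ 2)) ∂gaussianReal 0 1 :=
        lintegral_pi_prod _ (fun i x => ENNReal.ofReal (Real.exp (b i * σ * x ^ 2)))
          (fun i => by fun_prop)
    _ ≤ ∏ i, ENNReal.ofReal (Real.exp (3 * (b i * σ))) :=
        Finset.prod_le_prod' fun i _ =>
          lintegral_exp_mul_sq_gaussianReal_le (mul_nonneg (hb0 i) hσ) (hb i)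
    _ = _ := by
        rw [← ENNReal.ofReal_prod_of_nonneg (fun _ _ => (Real.exp_pos _).le), ← Real.exp_sum,
          Finset.mul_sum]
        congr 2
        exact Finset.sum_congr rfl fun i _ => by ring

/-- Functions of disjoint rows of an array of independent variables are independent: the lower
Lebesgue integral of their product factors. -/
theorem lintegral_prod_rows {Ω κ τ : Type*} [MeasurableSpace Ω] [DecidableEq κ] [Fintype τ]
    {P : Measure Ω} [IsProbabilityMeasure P] {Z : κ × τ → Ω → ℝ} (hZ : iIndepFun Z P)
    (hm : ∀ k, AEMeasurable (Z k) P) {f : κ → (τ → ℝ) → ENNReal} (hf : ∀ i, Measurable (f i))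
    (A : Finset κ) :
    ∫⁻ ω, ∏ i ∈ A, f i (fun j => Z (i, j) ω) ∂P =
      ∏ i ∈ A, ∫⁻ ω, f i (fun j => Z (i, j) ω) ∂P := by
  classical
  have hrow : ∀ i, AEMeasurable (fun ω => f i (fun j => Z (i, j) ω)) P := fun i =>
    (hf i).comp_aemeasurable (aemeasurable_pi_lambda _ fun j => hm (i, j))
  induction A using Finset.induction_on with
  | empty => simp
  | insert i A hi ih =>
    simp_rw [Finset.prod_insert hi]
    rw [← ih]
    refine lintegral_mul_eq_lintegral_mul_lintegral_of_indepFun' (hrow i)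
      (Finset.aemeasurable_fun_prod _ fun k _ => hrow k) ?_
    have hdisj : Disjoint ({i} ×ˢ (Finset.univ : Finset τ)) (A ×ˢ Finset.univ) :=
      Finset.disjoint_product.2 (Or.inl (Finset.disjoint_singleton_left.2 hi))
    have hind := hZ.indepFun_finset₀ _ _ hdisj hm
    let F : ((({i} : Finset κ) ×ˢ (Finset.univ : Finset τ) : Finset (κ × τ)) → ℝ) → ENNReal :=
      fun z => f i fun j => z ⟨(i, j), by simp⟩
    let G : ((A ×ˢ (Finset.univ : Finset τ) : Finset (κ × τ)) → ℝ) → ENNReal :=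
      fun z => ∏ k : A, f k fun j => z ⟨(k, j), by simp⟩
    have hF : Measurable F := (hf i).comp (measurable_pi_lambda _ fun j => measurable_pi_apply _)
    have hG : Measurable G := Finset.measurable_fun_prod _ fun k _ =>
      (hf k).comp (measurable_pi_lambda _ fun j => measurable_pi_apply _)
    have e : (fun ω => ∏ k ∈ A, f k fun j => Z (k, j) ω) =
        G ∘ fun ω (k : (A ×ˢ (Finset.univ : Finset τ) : Finset (κ × τ))) => Z k ω :=
      funext fun ω => (Finset.prod_coe_sort A fun k => f k fun j => Z (k, j) ω).symm
    rw [e]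
    exact hind.comp hF hG

/-- A second-order bound of the exponential function. -/
theorem exp_le_one_add_add_sq_mul_exp_abs (x : ℝ) :
    Real.exp x ≤ 1 + x + x ^ 2 * Real.exp |x| := by
  have h := Complex.norm_exp_sub_sum_le_norm_mul_exp (x : ℂ) 2
  rw [Complex.norm_real, Real.norm_eq_abs, sq_abs] at h
  have h' := (Complex.re_le_norm _).trans h
  have e : (Complex.exp (x : ℂ)).re = Real.exp x := Complex.exp_ofReal_re x
  simp [Finset.sum_range_succ, e] at h'
  linarith

/-- Exponential moments of the centred square of a sub-Gaussian variable of variance one. -/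
theorem lintegral_exp_mul_sq_sub_one_le {Ω : Type*} [MeasurableSpace Ω] {P : Measure Ω}
    [IsProbabilityMeasure P] {Y : Ω → ℝ} {p l : ℝ} (hp : 0 < p)
    (hY : AEMeasurable Y P)
    (h : ∀ t : ℝ, ∫⁻ ω, ENNReal.ofReal (Real.exp (t * Y ω)) ∂P ≤
      ENNReal.ofReal (Real.exp (t ^ 2 / (2 * p))))
    (hI : Integrable (fun ω => Y ω ^ 2) P) (h2 : ∫ ω, Y ω ^ 2 ∂P = 1) (hp1 : p ≤ 1)
    (hl : |l| ≤ p / 6) :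
    ∫⁻ ω, ENNReal.ofReal (Real.exp (l * (Y ω ^ 2 - 1))) ∂P ≤
      ENNReal.ofReal (Real.exp (288 * l ^ 2 / p ^ 2)) := by
  set E : Ω → ℝ := fun ω => Real.exp (p / 3 * Y ω ^ 2) with hE
  have hEm : AEStronglyMeasurable E P := AEMeasurable.aestronglyMeasurable (by fun_prop)
  -- With proxy `σ = 1 / p`, the weight `p / 3` is the largest one allowed by `b σ ≤ 1 / 3`, and `3
  -- σ b = 1`.
  have hE1 : ∫⁻ ω, ENNReal.ofReal (E ω) ∂P ≤ ENNReal.ofReal (Real.exp 1) := by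
    have := lintegral_exp_sum_mul_sq_le (ι := Unit) (X := fun _ => Y) (P := P) (σ := 1 / p)
      (fun _ => hY) (by positivity) (fun v => by
        simp only [Finset.univ_unique, Finset.sum_singleton]
        refine (h _).trans_eq ?_
        congr 2
        field_simp) (b := fun _ => p / 3) (fun _ => by positivity)
      (fun _ => by field_simp; rfl)
    simp only [Finset.univ_unique, Finset.sum_singleton] at this
    convert this using 3
    field_simp
  have hE0 : 0 ≤ᵐ[P] E := ae_of_all _ fun _ => (Real.exp_pos _).le
  have hEi : Integrable E P := (lintegral_ofReal_ne_top_iff_integrable hEm hE0).1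
    (ne_top_of_le_ne_top ENNReal.ofReal_ne_top hE1)
  have hE2 : ∫ ω, E ω ∂P ≤ Real.exp 1 := by
    rw [integral_eq_lintegral_of_nonneg_ae hE0 hEm]
    exact ENNReal.toReal_le_of_le_ofReal (Real.exp_pos _).le hE1
  -- The linear term integrates to zero since the second moment is one, so only a term of order `l ^
  -- 2` survives. The constant `72` comes from `x ^ 2 / 2 ≤ exp x` at `x = p W / 6`; the final `288`
  -- is `72 * 4`, by `hexp4`.
  have hpt : ∀ ω, Real.exp (l * (Y ω ^ 2 - 1)) ≤
      1 + l * (Y ω ^ 2 - 1) + l ^ 2 * (72 / p ^ 2) * Real.exp (p / 3) * E ω := fun ω => by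
    refine (exp_le_one_add_add_sq_mul_exp_abs _).trans (add_le_add le_rfl ?_)
    set W := Y ω ^ 2 + 1 with hW
    have hW0 : 0 ≤ W := by positivity
    have habs : |Y ω ^ 2 - 1| ≤ W := abs_le.2 ⟨by nlinarith [sq_nonneg (Y ω)], by linarith⟩
    have h3 : (Y ω ^ 2 - 1) ^ 2 ≤ W ^ 2 := sq_le_sq' (abs_le.1 habs).1 (abs_le.1 habs).2
    have h4 : |l * (Y ω ^ 2 - 1)| ≤ p / 6 * W := by
      rw [abs_mul]
      gcongr
    have h5 : W ^ 2 ≤ 72 / p ^ 2 * Real.exp (p / 6 * W) := by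
      have := Real.quadratic_le_exp_of_nonneg (x := p / 6 * W) (by positivity)
      rw [div_mul_eq_mul_div, le_div_iff₀ (by positivity)]
      have : 0 ≤ p / 6 * W := by positivity
      nlinarith
    calc (l * (Y ω ^ 2 - 1)) ^ 2 * Real.exp |l * (Y ω ^ 2 - 1)|
        = l ^ 2 * ((Y ω ^ 2 - 1) ^ 2 * Real.exp |l * (Y ω ^ 2 - 1)|) := by ring
      _ ≤ l ^ 2 * (72 / p ^ 2 * Real.exp (p / 6 * W) * Real.exp (p / 6 * W)) := by
        gcongr
        exact h3.trans h5
      _ = l ^ 2 * (72 / p ^ 2) * (Real.exp (p / 6 * W) * Real.exp (p / 6 * W)) := by ring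
      _ = l ^ 2 * (72 / p ^ 2) * (Real.exp (p / 3) * E ω) := by
        rw [hE, ← Real.exp_add, ← Real.exp_add]
        congr 2
        rw [hW]
        ring
      _ = _ := by ring
  have hi1 : Integrable (fun ω => l * (Y ω ^ 2 - 1)) P :=
    (hI.sub (integrable_const 1)).const_mul l
  have hi2 : Integrable (fun ω => 1 + l * (Y ω ^ 2 - 1)) P := (integrable_const 1).add hi1
  have hi3 := hEi.const_mul (l ^ 2 * (72 / p ^ 2) * Real.exp (p / 3))
  have hexp4 : Real.exp (p / 3) * Real.exp 1 ≤ 4 := by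
    rw [← Real.exp_add]
    refine (Real.exp_le_exp.2 (show p / 3 + 1 ≤ 4 / 3 by linarith)).trans ?_
    refine le_of_pow_le_pow_left₀ (n := 3) (by norm_num) (by norm_num) ?_
    rw [← Real.exp_nat_mul]
    have h6 : Real.exp (((3 : ℕ) : ℝ) * (4 / 3)) = Real.exp 1 ^ 4 := by
      rw [← Real.exp_nat_mul]
      norm_num
    rw [h6]
    calc Real.exp 1 ^ 4 ≤ 2.72 ^ 4 := by
          gcongr
          linarith [Real.exp_one_lt_d9]
      _ ≤ 4 ^ 3 := by norm_num
  calc _ ≤ ∫⁻ ω, ENNReal.ofReal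
          (1 + l * (Y ω ^ 2 - 1) + l ^ 2 * (72 / p ^ 2) * Real.exp (p / 3) * E ω) ∂P :=
        lintegral_mono fun ω => ENNReal.ofReal_le_ofReal (hpt ω)
    _ = ENNReal.ofReal (∫ ω,
          (1 + l * (Y ω ^ 2 - 1) + l ^ 2 * (72 / p ^ 2) * Real.exp (p / 3) * E ω) ∂P) :=
        (ofReal_integral_eq_lintegral_ofReal (hi2.add hi3)
          (ae_of_all _ fun ω => (Real.exp_pos _).le.trans (hpt ω))).symm
    _ ≤ _ := by
        refine ENNReal.ofReal_le_ofReal ?_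
        have e1 : ∫ ω, (1 + l * (Y ω ^ 2 - 1) +
            l ^ 2 * (72 / p ^ 2) * Real.exp (p / 3) * E ω) ∂P =
            1 + l ^ 2 * (72 / p ^ 2) * Real.exp (p / 3) * ∫ ω, E ω ∂P := by
          rw [integral_add hi2 hi3, integral_const_mul]
          rw [integral_add (integrable_const _) hi1, integral_const_mul,
            integral_sub hI (integrable_const _), h2]
          simp
        rw [e1]
        have e2 : l ^ 2 * (72 / p ^ 2) * Real.exp (p / 3) * ∫ ω, E ω ∂P ≤
            288 * l ^ 2 / p ^ 2 := by
          calc _ ≤ l ^ 2 * (72 / p ^ 2) * Real.exp (p / 3) * Real.exp 1 := by gcongr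
            _ = l ^ 2 * (72 / p ^ 2) * (Real.exp (p / 3) * Real.exp 1) := by ring
            _ ≤ l ^ 2 * (72 / p ^ 2) * 4 := by gcongr
            _ = _ := by ring
        linarith [Real.add_one_le_exp (288 * l ^ 2 / p ^ 2)]

/-! ### Moments of the two entry laws and of linear forms in the entries -/

namespace Sketch

/-- A law on the real line is centred, of variance `1 / s`, and sub-Gaussian with variance proxy
`1 / (s p)`. -/
structure IsSubgaussianEntryLaw (s : ℕ) (p : ℝ) (ν : Measure ℝ) : Prop where
  hasSubgaussianMGF : HasSubgaussianMGF id (1 / (s * p)).toNNReal ν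
  integral_id : ∫ x, x ∂ν = 0
  integral_sq : ∫ x, x ^ 2 ∂ν = 1 / s

theorem integrable_rademacherEntryLaw (s : ℕ) (p : ℝ) (f : ℝ → ℝ) :
    Integrable f (rademacherEntryLaw s p) := by
  have h : ∀ a : ℝ, Integrable f (Measure.dirac a) := fun a => integrable_dirac (by simp)
  unfold rademacherEntryLaw
  exact (((h _).smul_measure ENNReal.ofReal_ne_top).add_measure
    ((h _).smul_measure ENNReal.ofReal_ne_top)).add_measure
    ((h _).smul_measure ENNReal.ofReal_ne_top)

theorem integral_rademacherEntryLaw {s : ℕ} {p : ℝ} (hp0 : 0 ≤ p) (hp1 : p ≤ 1) (f : ℝ → ℝ) :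
    ∫ x, f x ∂rademacherEntryLaw s p = p / 2 * f (1 / Real.sqrt (s * p)) + (1 - p) * f 0 +
      p / 2 * f (-1 / Real.sqrt (s * p)) := by
  have h : ∀ a : ℝ, Integrable f (Measure.dirac a) := fun a => integrable_dirac (by simp)
  have h' : ∀ (a : ℝ) (c : ℝ), Integrable f (ENNReal.ofReal c • Measure.dirac a) :=
    fun a c => (h a).smul_measure ENNReal.ofReal_ne_top
  unfold rademacherEntryLaw
  rw [integral_add_measure ((h' _ _).add_measure (h' _ _)) (h' _ _),
    integral_add_measure (h' _ _) (h' _ _)]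
  simp only [integral_smul_measure, integral_dirac, smul_eq_mul]
  rw [ENNReal.toReal_ofReal (by linarith), ENNReal.toReal_ofReal (by linarith)]

theorem integrable_gaussianEntryLaw {s : ℕ} {p : ℝ} {f : ℝ → ℝ} (hf : Measurable f)
    (hi : Integrable (fun x => f (1 / Real.sqrt (s * p) * x)) (gaussianReal 0 1)) :
    Integrable f (gaussianEntryLaw s p) := by
  unfold gaussianEntryLaw
  refine Integrable.add_measure (Integrable.smul_measure ?_ ENNReal.ofReal_ne_top)
    ((integrable_dirac (by simp)).smul_measure ENNReal.ofReal_ne_top)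
  exact (integrable_map_measure hf.aestronglyMeasurable (by fun_prop)).2 hi

theorem integral_gaussianEntryLaw {s : ℕ} {p : ℝ} (hp0 : 0 ≤ p) (hp1 : p ≤ 1) {f : ℝ → ℝ}
    (hf : Measurable f)
    (hi : Integrable (fun x => f (1 / Real.sqrt (s * p) * x)) (gaussianReal 0 1)) :
    ∫ x, f x ∂gaussianEntryLaw s p =
      p * ∫ x, f (1 / Real.sqrt (s * p) * x) ∂gaussianReal 0 1 + (1 - p) * f 0 := by
  unfold gaussianEntryLaw
  rw [integral_add_measure (Integrable.smul_measure
    ((integrable_map_measure hf.aestronglyMeasurable (by fun_prop)).2 hi) ENNReal.ofReal_ne_top)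
    ((integrable_dirac (by simp)).smul_measure ENNReal.ofReal_ne_top)]
  simp only [integral_smul_measure, integral_dirac, smul_eq_mul]
  rw [ENNReal.toReal_ofReal hp0, ENNReal.toReal_ofReal (by linarith),
    integral_map (by fun_prop) hf.aestronglyMeasurable]

/-- Mixing with an atom at `0` turns a moment generating function value `c` into `p c + (1 - p)`. A
sub-Gaussian bound is at least `1`, so sparsification preserves it. -/
theorem mul_add_one_sub_le {p c : ℝ} (hp1 : p ≤ 1) (hc : 1 ≤ c) : p * c + (1 - p) ≤ c := by
  nlinarith

theorem isSubgaussianEntryLaw_rademacher {s : ℕ} (hs : 0 < s) {p : ℝ} (hp0 : 0 < p)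
    (hp1 : p ≤ 1) : IsSubgaussianEntryLaw s p (rademacherEntryLaw s p) where
  hasSubgaussianMGF := by
    have hs' : (0 : ℝ) < s := Nat.cast_pos.2 hs
    refine ⟨fun t => integrable_rademacherEntryLaw _ _ _, fun t => ?_⟩
    rw [mgf, integral_rademacherEntryLaw hp0.le hp1 (fun x => Real.exp (t * id x)),
      Real.coe_toNNReal _ (by positivity)]
    have hc := Real.cosh_le_exp_half_sq (t * (1 / Real.sqrt (s * p)))
    rw [Real.cosh_eq, mul_pow, div_pow, Real.sq_sqrt (by positivity)] at hc
    have e : (1 / (s * p) * t ^ 2 / 2 : ℝ) = t ^ 2 * (1 ^ 2 / (s * p)) / 2 := by ring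
    simp only [id, mul_zero, Real.exp_zero, neg_div, mul_neg, e]
    refine le_trans ?_ (mul_add_one_sub_le hp1 (Real.one_le_exp (by positivity)))
    have := mul_le_mul_of_nonneg_left hc hp0.le
    linarith
  integral_id := by
    rw [integral_rademacherEntryLaw hp0.le hp1 (fun x => x)]
    ring
  integral_sq := by
    have hs' : (0 : ℝ) < s := Nat.cast_pos.2 hs
    rw [integral_rademacherEntryLaw hp0.le hp1 (fun x => x ^ 2)]
    simp only [div_pow]
    rw [Real.sq_sqrt (by positivity)]
    field_simp
    ring

theorem isSubgaussianEntryLaw_gaussian {s : ℕ} (hs : 0 < s) {p : ℝ} (hp0 : 0 < p)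
    (hp1 : p ≤ 1) : IsSubgaussianEntryLaw s p (gaussianEntryLaw s p) where
  hasSubgaussianMGF := by
    have hs' : (0 : ℝ) < s := Nat.cast_pos.2 hs
    have hi : ∀ t : ℝ, Integrable (fun x => Real.exp (t * (1 / Real.sqrt (s * p) * x)))
        (gaussianReal 0 1) := fun t => by
      simp_rw [← mul_assoc]
      exact integrable_exp_mul_gaussianReal _
    refine ⟨fun t => integrable_gaussianEntryLaw (f := fun x => Real.exp (t * id x))
      (by fun_prop) (hi t), fun t => ?_⟩
    rw [mgf, integral_gaussianEntryLaw hp0.le hp1 (f := fun x => Real.exp (t * id x))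
      (by fun_prop) (hi t), Real.coe_toNNReal _ (by positivity)]
    have hg := congrFun (mgf_fun_id_gaussianReal (μ := 0) (v := 1)) (t * (1 / Real.sqrt (s * p)))
    rw [mgf] at hg
    simp only [id, ← mul_assoc t, hg]
    rw [mul_pow t, div_pow, Real.sq_sqrt (by positivity), mul_zero, Real.exp_zero, mul_one,
      zero_mul, zero_add, NNReal.coe_one, one_mul]
    have e : (1 / (s * p) * t ^ 2 / 2 : ℝ) = t ^ 2 * (1 ^ 2 / (s * p)) / 2 := by ring
    rw [e]
    exact mul_add_one_sub_le hp1 (Real.one_le_exp (by positivity))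
  integral_id := by
    have hi : Integrable (fun x : ℝ => x) (gaussianReal 0 1) :=
      (memLp_id_gaussianReal 1).integrable (by simp)
    rw [integral_gaussianEntryLaw hp0.le hp1 (f := fun x => x) measurable_id (hi.const_mul _),
      mul_zero, add_zero]
    rw [integral_const_mul, integral_id_gaussianReal]
    simp
  integral_sq := by
    have hs' : (0 : ℝ) < s := Nat.cast_pos.2 hs
    have hi : Integrable (fun x : ℝ => x ^ 2) (gaussianReal 0 1) :=
      (memLp_id_gaussianReal 2).integrable_sq
    have h2 : ∫ x, x ^ 2 ∂gaussianReal 0 1 = 1 := by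
      have := variance_fun_id_gaussianReal (μ := 0) (v := 1)
      rwa [variance_of_integral_eq_zero (by fun_prop) integral_id_gaussianReal] at this
    rw [integral_gaussianEntryLaw hp0.le hp1 (f := fun x => x ^ 2) (by fun_prop)
      (by simp_rw [mul_pow]; exact hi.const_mul _)]
    simp_rw [mul_pow]
    rw [integral_const_mul, h2, div_pow, Real.sq_sqrt (by positivity)]
    field_simp
    ring

/-- Laplace transform of a linear form in the entries of a random matrix. -/
theorem HasIIDEntries.lintegral_exp_sum_le {Ω : Type*} [MeasurableSpace Ω] {P : Measure Ω}
    {s n : ℕ} {S : Ω → Matrix (Fin s) (Fin n) ℝ} {ν : Measure ℝ} {p : ℝ} (hp : 0 ≤ p)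
    (hS : HasIIDEntries P S ν) (hν : IsSubgaussianEntryLaw s p ν) (a : Fin s × Fin n → ℝ) :
    ∫⁻ ω, ENNReal.ofReal (Real.exp (∑ k, a k * S ω k.1 k.2)) ∂P ≤
      ENNReal.ofReal (Real.exp (1 / (s * p) * (∑ k, a k ^ 2) / 2)) := by
  have h1 : ∀ k : Fin s × Fin n, HasSubgaussianMGF (fun ω => S ω k.1 k.2)
      (1 / (s * p)).toNNReal P := fun k =>
    (HasSubgaussianMGF.id_map_iff (hS.hasLaw k.1 k.2).aemeasurable).1
      ((hS.hasLaw k.1 k.2).map_eq.symm ▸ hν.hasSubgaussianMGF)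
  have h2 : iIndepFun (fun (k : Fin s × Fin n) ω => a k * S ω k.1 k.2) P :=
    hS.indep.comp (fun k x => a k * x) fun k => by fun_prop
  have hc : ∀ k : Fin s × Fin n, HasSubgaussianMGF (fun ω => a k * S ω k.1 k.2)
      ((a k ^ 2).toNNReal * (1 / (s * p)).toNNReal) P := fun k => by
    rw [Real.toNNReal_of_nonneg (sq_nonneg (a k))]
    exact (h1 k).const_mul (a k)
  have h3 := HasSubgaussianMGF.sum_of_iIndepFun h2 (s := Finset.univ) fun k _ => hc k
  have h4 := h3.integrable_exp_mul 1
  have h5 := h3.mgf_le 1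
  simp only [mgf, one_mul] at h4 h5
  rw [← ofReal_integral_eq_lintegral_ofReal h4 (ae_of_all _ fun _ => (Real.exp_pos _).le)]
  refine ENNReal.ofReal_le_ofReal (h5.trans_eq ?_)
  congr 1
  rw [NNReal.coe_sum, one_pow, mul_one, Finset.mul_sum]
  congr 1
  refine Finset.sum_congr rfl fun k _ => ?_
  rw [NNReal.coe_mul, Real.coe_toNNReal _ (sq_nonneg _), Real.coe_toNNReal _ (by positivity),
    mul_comm]

/-- Second moment of a linear form in a row of a random matrix. -/
theorem HasIIDEntries.integral_sq_row {Ω : Type*} [MeasurableSpace Ω] {P : Measure Ω}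
    [IsProbabilityMeasure P]
    {s n : ℕ} {S : Ω → Matrix (Fin s) (Fin n) ℝ} {ν : Measure ℝ} {p : ℝ}
    (hS : HasIIDEntries P S ν) (hν : IsSubgaussianEntryLaw s p ν) (w : Fin n → ℝ) (i : Fin s) :
    Integrable (fun ω => (∑ j, S ω i j * w j) ^ 2) P ∧
      ∫ ω, (∑ j, S ω i j * w j) ^ 2 ∂P = (∑ j, w j ^ 2) / s := by
  have h1 : ∀ j, MemLp (fun ω => S ω i j * w j) 2 P := fun j => by
    have : HasSubgaussianMGF (fun ω => S ω i j) (1 / (s * p)).toNNReal P :=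
      (HasSubgaussianMGF.id_map_iff (hS.hasLaw i j).aemeasurable).1
        ((hS.hasLaw i j).map_eq.symm ▸ hν.hasSubgaussianMGF)
    exact (this.memLp 2).mul_const (w j)
  have h2 : MemLp (fun ω => ∑ j, S ω i j * w j) 2 P := memLp_finsetSum _ fun j _ => h1 j
  refine ⟨h2.integrable_sq, ?_⟩
  have h0 : ∀ j, ∫ ω, S ω i j * w j ∂P = 0 := fun j => by
    rw [integral_mul_const]
    have := (hS.hasLaw i j).integral_comp (f := fun x => x) (by fun_prop)
    rw [hν.integral_id] at this
    rw [show ∫ ω, S ω i j ∂P = 0 from this, zero_mul]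
  have h3 : ∀ j, variance (fun ω => S ω i j * w j) P = w j ^ 2 / s := fun j => by
    rw [variance_of_integral_eq_zero (h1 j).aemeasurable (h0 j)]
    simp_rw [mul_pow]
    rw [integral_mul_const]
    have := (hS.hasLaw i j).integral_comp (f := fun x => x ^ 2) (by fun_prop)
    rw [hν.integral_sq] at this
    rw [show ∫ ω, S ω i j ^ 2 ∂P = 1 / s from this]
    ring
  have hpair : Set.Pairwise ((Finset.univ : Finset (Fin n)) : Set (Fin n))
      fun j k => (fun ω => S ω i j * w j) ⟂ᵢ[P] (fun ω => S ω i k * w k) := fun j _ k _ hjk =>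
    (hS.indep.indepFun (i := (i, j)) (j := (i, k)) (by simpa using hjk)).comp
      (φ := fun x => x * w j) (ψ := fun x => x * w k) (by fun_prop) (by fun_prop)
  have h4 := IndepFun.variance_sum (X := fun j ω => S ω i j * w j) (s := Finset.univ)
    (fun j _ => h1 j) hpair
  simp only [h3] at h4
  have e : (∑ j, fun ω => S ω i j * w j) = fun ω => ∑ j, S ω i j * w j := by
    ext ω
    simp
  rw [e, variance_of_integral_eq_zero h2.aemeasurable (by
    rw [integral_finsetSum _ fun j _ => (h1 j).integrable (by norm_num)]
    exact Finset.sum_eq_zero fun j _ => h0 j)] at h4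
  rw [h4, Finset.sum_div]

end Sketch

/-! ### Deviation bounds for a fixed vector -/

/-- Chernoff bound with lower Lebesgue integrals. -/
theorem measure_le_of_lintegral_exp_le {Ω : Type*} [MeasurableSpace Ω] {P : Measure Ω}
    {f : Ω → ℝ} (hf : AEMeasurable f P) {A : ℝ}
    (h : ∫⁻ ω, ENNReal.ofReal (Real.exp (f ω)) ∂P ≤ ENNReal.ofReal (Real.exp A)) (B : ℝ) :
    P {ω | B ≤ f ω} ≤ ENNReal.ofReal (Real.exp (A - B)) := by
  have h1 := mul_meas_ge_le_lintegral₀ (μ := P)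
    (f := fun ω => ENNReal.ofReal (Real.exp (f ω))) (by fun_prop) (ENNReal.ofReal (Real.exp B))
  have hset : {ω | B ≤ f ω} ⊆
      {ω | ENNReal.ofReal (Real.exp B) ≤ ENNReal.ofReal (Real.exp (f ω))} := fun ω hω =>
    ENNReal.ofReal_le_ofReal (Real.exp_le_exp.2 hω)
  have h2 : ENNReal.ofReal (Real.exp B) * P {ω | B ≤ f ω} ≤ ENNReal.ofReal (Real.exp A) :=
    (mul_le_mul_right (measure_mono hset) _).trans (h1.trans h)
  rw [Real.exp_sub, ENNReal.ofReal_div_of_pos (Real.exp_pos B), ENNReal.le_div_iff_mul_le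
    (Or.inl (by simp [Real.exp_pos])) (Or.inl ENNReal.ofReal_ne_top), mul_comm]
  exact h2

namespace Sketch

theorem sum_mulVec_sq {ι κ : Type*} [Fintype ι] [Fintype κ] [DecidableEq κ] {V : Matrix ι κ ℝ}
    (hV : V.transpose * V = 1) (v : κ → ℝ) : ∑ k, (V.mulVec v) k ^ 2 = ∑ j, v j ^ 2 := by
  have : V.mulVec v ⬝ᵥ V.mulVec v = v ⬝ᵥ v := by
    rw [Matrix.dotProduct_mulVec, Matrix.vecMul_mulVec, hV, Matrix.vecMul_one]
  simpa [dotProduct, sq] using this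

variable {Ω : Type*} [MeasurableSpace Ω] {P : Measure Ω} [IsProbabilityMeasure P] {s n : ℕ}
  {S : Ω → Matrix (Fin s) (Fin n) ℝ} {ν : Measure ℝ} {p : ℝ}

/-- Exponential moments of the deviation of `‖S w‖ ^ 2` from `1`. -/
theorem HasIIDEntries.lintegral_exp_sq_sub_one_le (hs : 0 < s) (hp0 : 0 < p) (hp1 : p ≤ 1)
    (hS : HasIIDEntries P S ν) (hν : IsSubgaussianEntryLaw s p ν) {w : Fin n → ℝ}
    (hw : ∑ j, w j ^ 2 = 1) {l : ℝ} (hl : |l| ≤ p / 6) :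
    ∫⁻ ω, ENNReal.ofReal (Real.exp (l * s * (∑ i, (∑ j, S ω i j * w j) ^ 2 - 1))) ∂P ≤
      ENNReal.ofReal (Real.exp (s * (288 * l ^ 2 / p ^ 2))) := by
  have hs' : (0 : ℝ) < s := Nat.cast_pos.2 hs
  have hmeas : ∀ i j, AEMeasurable (fun ω => S ω i j) P := fun i j => (hS.hasLaw i j).aemeasurable
  have hrow : ∀ i, ∫⁻ ω, ENNReal.ofReal
      (Real.exp (l * ((Real.sqrt s * ∑ j, S ω i j * w j) ^ 2 - 1))) ∂P ≤
      ENNReal.ofReal (Real.exp (288 * l ^ 2 / p ^ 2)) := fun i => by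
    obtain ⟨hI, h2⟩ := hS.integral_sq_row hν w i
    refine lintegral_exp_mul_sq_sub_one_le hp0 ?_ (fun t => ?_) ?_ ?_ hp1 hl
    · exact (Finset.aemeasurable_fun_sum _ fun j _ => (hmeas i j).mul_const _).const_mul _
    -- Coefficients supported on row `i`, so that the linear form in the whole matrix is `t` times
    -- the normalized row form.
    · have h := hS.lintegral_exp_sum_le hp0.le hν
        (fun k => if k.1 = i then t * Real.sqrt s * w k.2 else 0)
      simp only [Fintype.sum_prod_type, ite_mul, zero_mul, ite_pow, ne_eq, OfNat.ofNat_ne_zero,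
        not_false_eq_true, zero_pow, Finset.sum_ite_irrel, Finset.sum_const_zero,
        Finset.sum_ite_eq', Finset.mem_univ, if_true] at h
      have e1 : ∀ ω, ∑ j, t * Real.sqrt s * w j * S ω i j =
          t * (Real.sqrt s * ∑ j, S ω i j * w j) := fun ω => by
        rw [Finset.mul_sum, Finset.mul_sum]
        exact Finset.sum_congr rfl fun j _ => by ring
      have e2 : 1 / (s * p) * ∑ j, (t * Real.sqrt s * w j) ^ 2 / 2 = t ^ 2 / (2 * p) := by
        simp_rw [mul_pow]
        rw [← Finset.sum_div, ← Finset.mul_sum, hw, Real.sq_sqrt hs'.le]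
        field_simp
      simp_rw [e1] at h
      rwa [mul_div_assoc, Finset.sum_div, e2] at h
    · simp_rw [mul_pow]
      exact hI.const_mul _
    · simp_rw [mul_pow]
      rw [integral_const_mul, h2, hw, Real.sq_sqrt hs'.le]
      field_simp
  have hprod := lintegral_prod_rows hS.indep (fun k => hmeas k.1 k.2)
    (f := fun _ z => ENNReal.ofReal (Real.exp (l * ((Real.sqrt s * ∑ j, z j * w j) ^ 2 - 1))))
    (fun _ => by fun_prop) Finset.univ
  calc _ = ∫⁻ ω, ∏ i, ENNReal.ofReal
        (Real.exp (l * ((Real.sqrt s * ∑ j, S ω i j * w j) ^ 2 - 1))) ∂P := by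
        refine lintegral_congr fun ω => ?_
        rw [← ENNReal.ofReal_prod_of_nonneg fun _ _ => (Real.exp_pos _).le, ← Real.exp_sum]
        congr 2
        simp_rw [mul_pow, Real.sq_sqrt hs'.le]
        rw [← Finset.mul_sum, Finset.sum_sub_distrib, ← Finset.mul_sum]
        simp
        ring
    _ = _ := hprod
    _ ≤ ∏ _i : Fin s, ENNReal.ofReal (Real.exp (288 * l ^ 2 / p ^ 2)) :=
        Finset.prod_le_prod' fun i _ => hrow i
    _ = _ := by
        rw [Finset.prod_const, Finset.card_univ, Fintype.card_fin,
          ← ENNReal.ofReal_pow (Real.exp_pos _).le, ← Real.exp_nat_mul]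

/-- Concentration of `‖S w‖ ^ 2` for a fixed unit vector `w`. -/
theorem HasIIDEntries.measure_sq_sub_one_le (hs : 0 < s) (hp0 : 0 < p) (hp1 : p ≤ 1)
    (hS : HasIIDEntries P S ν) (hν : IsSubgaussianEntryLaw s p ν) {w : Fin n → ℝ}
    (hw : ∑ j, w j ^ 2 = 1) :
    P {ω | 1 / 4 ≤ |∑ i, (∑ j, S ω i j * w j) ^ 2 - 1|} ≤
      ENNReal.ofReal (2 * Real.exp (-(s * p ^ 2 / 18432))) := by
  have hs' : (0 : ℝ) < s := Nat.cast_pos.2 hs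
  -- The value `l = p ^ 2 / 2304` minimizes the Chernoff exponent `288 l ^ 2 / p ^ 2 - l / 4`, with
  -- minimum `-p ^ 2 / 18432`.
  have hl : p ^ 2 / 2304 ≤ p / 6 := by nlinarith
  have hmeas : ∀ l : ℝ, AEMeasurable
      (fun ω => l * s * (∑ i, (∑ j, S ω i j * w j) ^ 2 - 1)) P := fun l => by
    refine ((Finset.aemeasurable_fun_sum _ fun i _ => AEMeasurable.pow_const
      (Finset.aemeasurable_fun_sum _ fun j _ => ?_) 2).sub_const 1).const_mul _
    exact (hS.hasLaw i j).aemeasurable.mul_const _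
  have hside : ∀ l : ℝ, |l| = p ^ 2 / 2304 →
      P {ω | p ^ 2 / 2304 * s / 4 ≤ l * s * (∑ i, (∑ j, S ω i j * w j) ^ 2 - 1)} ≤
        ENNReal.ofReal (Real.exp (-(s * p ^ 2 / 18432))) := fun l hl' => by
    refine (measure_le_of_lintegral_exp_le (hmeas l)
      (hS.lintegral_exp_sq_sub_one_le hs hp0 hp1 hν hw (hl'.trans_le hl)) _).trans_eq ?_
    rw [← sq_abs l, hl']
    congr 2
    field_simp
    ring
  have hsub : {ω | 1 / 4 ≤ |∑ i, (∑ j, S ω i j * w j) ^ 2 - 1|} ⊆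
      {ω | p ^ 2 / 2304 * s / 4 ≤ p ^ 2 / 2304 * s * (∑ i, (∑ j, S ω i j * w j) ^ 2 - 1)} ∪
      {ω | p ^ 2 / 2304 * s / 4 ≤
        -(p ^ 2 / 2304) * s * (∑ i, (∑ j, S ω i j * w j) ^ 2 - 1)} := fun ω hω => by
    have hc : 0 < p ^ 2 / 2304 * s := by positivity
    simp only [Set.mem_ofPred_eq, Set.mem_union] at hω ⊢
    rcases le_abs.1 hω with h | h
    · left; nlinarith
    · right; nlinarith
  refine (measure_mono hsub).trans ((measure_union_le _ _).trans ?_)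
  rw [two_mul, ENNReal.ofReal_add (Real.exp_pos _).le (Real.exp_pos _).le]
  exact add_le_add (hside _ (abs_of_pos (by positivity)))
    (hside _ (by rw [abs_neg, abs_of_pos (by positivity)]))

/-- Deviation bound for the weighted norm `∑ⱼ mⱼ ⟨Vⱼ, Sᵀ u⟩ ^ 2`, where the columns `Vⱼ` are
orthonormal and `u` is a unit vector. -/
theorem HasIIDEntries.measure_weighted_sq_le (hs : 0 < s) (hp0 : 0 < p)
    (hS : HasIIDEntries P S ν) (hν : IsSubgaussianEntryLaw s p ν) {J : Type*} [Fintype J]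
    [DecidableEq J] {V : Matrix (Fin n) J ℝ} (hV : V.transpose * V = 1) {m : J → ℝ} {t : ℝ}
    (ht : 0 < t) (hm0 : ∀ j, 0 ≤ m j) (hm : ∀ j, m j ≤ t) (hsum : ∑ j, m j ≤ s * t)
    {u : Fin s → ℝ} (hu : ∑ i, u i ^ 2 = 1) (T : ℝ) :
    P {ω | T * t / p ≤ ∑ j, m j * (∑ i, (S ω * V) i j * u i) ^ 2} ≤
      ENNReal.ofReal (Real.exp (s - s * T / 3)) := by
  have hs' : (0 : ℝ) < s := Nat.cast_pos.2 hs
  have hmeas : ∀ i j, AEMeasurable (fun ω => S ω i j) P := fun i j => (hS.hasLaw i j).aemeasurable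
  have hX : ∀ j, AEMeasurable (fun ω => ∑ i, (S ω * V) i j * u i) P := fun j => by
    refine Finset.aemeasurable_fun_sum _ fun i _ => AEMeasurable.mul_const ?_ _
    simp only [Matrix.mul_apply]
    exact Finset.aemeasurable_fun_sum _ fun k _ => (hmeas i k).mul_const _
  have hlap : ∀ v : J → ℝ,
      ∫⁻ ω, ENNReal.ofReal (Real.exp (∑ j, v j * ∑ i, (S ω * V) i j * u i)) ∂P ≤
        ENNReal.ofReal (Real.exp (1 / (s * p) * (∑ j, v j ^ 2) / 2)) := fun v => by
    -- The form `⟨v, Vᵀ Sᵀ u⟩` pairs `S` with the rank-one matrix `u (V v)ᵀ`, whose Frobenius norm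
    -- is `‖v‖`.
    have h := hS.lintegral_exp_sum_le hp0.le hν (fun k => u k.1 * (V.mulVec v) k.2)
    have e2 : ∑ k : Fin s × Fin n, (u k.1 * (V.mulVec v) k.2) ^ 2 = ∑ j, v j ^ 2 := by
      simp_rw [Fintype.sum_prod_type, mul_pow, ← Finset.mul_sum]
      rw [← Finset.sum_mul, hu, one_mul, sum_mulVec_sq hV]
    rw [e2] at h
    have e1 : ∀ ω, ∑ j, v j * ∑ i, (S ω * V) i j * u i =
        ∑ k : Fin s × Fin n, u k.1 * (V.mulVec v) k.2 * S ω k.1 k.2 := fun ω => by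
      simp only [Fintype.sum_prod_type, Matrix.mul_apply, Matrix.mulVec, dotProduct,
        Finset.mul_sum, Finset.sum_mul]
      rw [Finset.sum_comm]
      refine Finset.sum_congr rfl fun i _ => ?_
      rw [Finset.sum_comm]
      refine Finset.sum_congr rfl fun k _ => Finset.sum_congr rfl fun j _ => ?_
      ring
    simp_rw [e1]
    exact h

  -- The weights are scaled so that `b σ = m / (3 t) ≤ 1 / 3`. The moment exponent is then `(∑ⱼ mⱼ)
  -- / t`, at most `s` by `hsum`.
  have hquad := lintegral_exp_sum_mul_sq_le hX (by positivity) hlap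
    (b := fun j => s * p / (3 * t) * m j) (fun j => mul_nonneg (by positivity) (hm0 j))
    (fun j => by
      rw [show s * p / (3 * t) * m j * (1 / (s * p)) = m j / t / 3 by field_simp]
      linarith [(div_le_one ht).2 (hm j)])
  have hbound : 3 * (1 / (s * p)) * ∑ j, s * p / (3 * t) * m j ≤ (s : ℝ) := by
    rw [← Finset.mul_sum, show 3 * (1 / (s * p)) * (s * p / (3 * t) * ∑ j, m j) =
      (∑ j, m j) / t by field_simp]
    exact (div_le_iff₀ ht).2 hsum
  have h := measure_le_of_lintegral_exp_le
    (Finset.aemeasurable_fun_sum _ fun j _ => ((hX j).pow_const 2).const_mul _)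
    (hquad.trans (ENNReal.ofReal_le_ofReal (Real.exp_le_exp.2 hbound))) (s * T / 3)
  refine (measure_mono fun ω hω => ?_).trans h
  simp only [Set.mem_ofPred_eq, mul_assoc _ (m _), ← Finset.mul_sum] at hω ⊢
  calc s * T / 3 = s * p / (3 * t) * (T * t / p) := by field_simp
    _ ≤ _ := mul_le_mul_of_nonneg_left hω (by positivity)

end Sketch

/-! ### Critical radius, statistical dimension and the spectral tail -/

namespace Sketch

variable {n : ℕ} {μ : Fin n → ℝ}

theorem criticalRadiusSq_nonneg (μ : Fin n → ℝ) : 0 ≤ criticalRadiusSq μ :=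
  Real.sInf_nonneg fun _ ht => ht.1.le

theorem continuous_kernelComplexity (μ : Fin n → ℝ) : Continuous (kernelComplexity μ) := by
  unfold kernelComplexity
  fun_prop

/-- The infimum lies in the closure of the defining set, and the inequality, unlike the positivity
of `t`, is a closed condition. The set is nonempty because it contains `1`. -/
theorem kernelComplexity_criticalRadiusSq_le (hn : 0 < n) (μ : Fin n → ℝ) :
    kernelComplexity μ (criticalRadiusSq μ) ≤ criticalRadiusSq μ := by
  have hne : {t : ℝ | 0 < t ∧ kernelComplexity μ t ≤ t}.Nonempty := by
    refine ⟨1, one_pos, ?_⟩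
    have hn' : (0 : ℝ) < n := Nat.cast_pos.2 hn
    refine Real.sqrt_le_one.2 ?_
    have h : ∑ i, min 1 (μ i) ≤ ∑ _i : Fin n, (1 : ℝ) :=
      Finset.sum_le_sum fun i _ => min_le_left _ _
    rw [Finset.sum_const, Finset.card_univ, Fintype.card_fin, nsmul_eq_mul, mul_one] at h
    rw [one_div, inv_mul_le_iff₀ hn', mul_one]
    exact h
  have hmem := csInf_mem_closure hne ⟨0, fun t ht => ht.1.le⟩
  exact closure_minimal (fun t ht => ht.2)
    (isClosed_le (continuous_kernelComplexity μ) continuous_id) hmem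

theorem sum_min_criticalRadiusSq_le (hn : 0 < n) (μ : Fin n → ℝ) :
    ∑ i, min (criticalRadiusSq μ) (μ i) ≤ n * criticalRadiusSq μ ^ 2 := by
  have hn' : (0 : ℝ) < n := Nat.cast_pos.2 hn
  have h := kernelComplexity_criticalRadiusSq_le hn μ
  rw [kernelComplexity, Real.sqrt_le_left (criticalRadiusSq_nonneg μ), one_div,
    inv_mul_le_iff₀ hn'] at h
  exact h

theorem statDim_pos (hn : 0 < n) (μ : Fin n → ℝ) : 0 < statDim μ := by
  unfold statDim
  split_ifs with h
  · obtain ⟨j, hj⟩ := h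
    obtain ⟨k, hk, -⟩ := Nat.sInf_mem
      (s := {m : ℕ | ∃ j : Fin n, m = (j : ℕ) + 1 ∧ μ j ≤ criticalRadiusSq μ}) ⟨_, j, rfl, hj⟩
    omega
  · exact hn

/-- If the minimum defining `dₙ` is attained at the 0-based index `k`, then `dₙ = k + 1`, so every
tail index lies beyond `k` and monotonicity applies. If no index qualifies, then `dₙ = n` and the
tail is empty. -/
theorem le_criticalRadiusSq_of_statDim_le (hμ : Antitone μ) {j : Fin n}
    (hj : statDim μ ≤ (j : ℕ)) : μ j ≤ criticalRadiusSq μ := by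
  unfold statDim at hj
  split_ifs at hj with h
  · obtain ⟨i, hi⟩ := h
    obtain ⟨k, hk, hk'⟩ := Nat.sInf_mem
      (s := {m : ℕ | ∃ j : Fin n, m = (j : ℕ) + 1 ∧ μ j ≤ criticalRadiusSq μ}) ⟨_, i, rfl, hi⟩
    exact (hμ (show k ≤ j from Fin.le_def.2 (by omega))).trans hk'
  · exact absurd j.2 (by omega)

/-- On the tail `μⱼ = min(δₙ², μⱼ)`, so the sum is part of the one controlled by the critical
inequality. -/
theorem sum_tail_le (hn : 0 < n) (hμ : Antitone μ) (hμ0 : ∀ i, 0 ≤ μ i) :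
    ∑ j : {j : Fin n // statDim μ ≤ (j : ℕ)}, μ j ≤ n * criticalRadiusSq μ ^ 2 := by
  refine le_trans ?_ (sum_min_criticalRadiusSq_le hn μ)
  calc ∑ j : {j : Fin n // statDim μ ≤ (j : ℕ)}, μ j
      = ∑ j : {j : Fin n // statDim μ ≤ (j : ℕ)}, min (criticalRadiusSq μ) (μ j) :=
        Finset.sum_congr rfl fun j _ =>
          (min_eq_right (le_criticalRadiusSq_of_statDim_le hμ j.2)).symm
    _ = ∑ j ∈ Finset.univ.filter fun j : Fin n => statDim μ ≤ j, min (criticalRadiusSq μ) (μ j) :=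
        (Finset.sum_subtype _ (by simp) fun j => min (criticalRadiusSq μ) (μ j)).symm
    _ ≤ _ := Finset.sum_le_sum_of_subset_of_nonneg (Finset.filter_subset _ _)
        fun i _ _ => le_min (criticalRadiusSq_nonneg μ) (hμ0 i)

theorem card_left_le (μ : Fin n → ℝ) :
    Fintype.card {j : Fin n // (j : ℕ) < statDim μ} ≤ statDim μ := by
  have := Fintype.card_le_of_injective
    (fun j : {j : Fin n // (j : ℕ) < statDim μ} => (⟨j.1, j.2⟩ : Fin (statDim μ)))
    fun a b hab => Subtype.ext (Fin.ext (by simpa using hab))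
  rwa [Fintype.card_fin] at this

theorem IsEigendecomposition.transpose_mul_self {K U : Matrix (Fin n) (Fin n) ℝ}
    (h : IsEigendecomposition K U μ) : U.transpose * U = 1 :=
  (Matrix.mem_orthogonalGroup_iff' (Fin n) ℝ).1 h.orthogonal

/-- The `μᵢ` are the diagonal entries of `Uᵀ (K / n) U`, which is positive semidefinite. -/
theorem IsEigendecomposition.nonneg {K U : Matrix (Fin n) (Fin n) ℝ}
    (h : IsEigendecomposition K U μ) (hK : K.PosSemidef) (i : Fin n) : 0 ≤ μ i := by
  have hU := h.transpose_mul_self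
  have h1 : ((1 / (n : ℝ)) • K).PosSemidef := hK.smul (by positivity)
  have h2 := (h1.conjTranspose_mul_mul_same U).diag_nonneg (i := i)
  rw [h.eq, Matrix.conjTranspose_eq_transpose_of_trivial] at h2
  rw [show U.transpose * (U * Matrix.diagonal μ * U.transpose) * U =
    U.transpose * U * Matrix.diagonal μ * (U.transpose * U) by simp only [Matrix.mul_assoc], hU]
    at h2
  simpa using h2

theorem submatrix_transpose_mul_self {U : Matrix (Fin n) (Fin n) ℝ} (hU : U.transpose * U = 1)
    (q : Fin n → Prop) :
    (U.submatrix id (Subtype.val : {j // q j} → Fin n)).transpose *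
      U.submatrix id (Subtype.val : {j // q j} → Fin n) = 1 := by
  rw [Matrix.transpose_submatrix, ← Matrix.submatrix_mul _ _ _ _ _ Function.bijective_id,
    hU]
  exact Matrix.submatrix_one _ Subtype.val_injective

/-! ### Matrix norms through nets -/

open scoped Matrix.Norms.L2Operator

/-- The operator norm of `Aᵀ A - 1` is controlled by the values of `‖A y‖ ^ 2 - 1` on a net. -/
theorem norm_transpose_mul_self_sub_one_le {ι κ : Type*} [Fintype ι] [Fintype κ] [DecidableEq ι]
    [DecidableEq κ] (A : Matrix ι κ ℝ) {N : Finset (EuclideanSpace ℝ κ)}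
    (hN1 : ∀ y ∈ N, ‖y‖ = 1)
    (hN : ∀ x : EuclideanSpace ℝ κ, ‖x‖ = 1 → ∃ y ∈ N, ‖x - y‖ ≤ 1 / 4) {a : ℝ} (ha : 0 ≤ a)
    (h : ∀ y ∈ N, |∑ i, (A.mulVec y) i ^ 2 - 1| ≤ a) :
    ‖A.transpose * A - 1‖ ≤ 2 * a := by
  rw [Matrix.l2_opNorm_def]
  set M := A.transpose * A - 1 with hM
  have hMt : M.IsHermitian := by
    rw [Matrix.IsHermitian, Matrix.conjTranspose_eq_transpose_of_trivial, hM]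
    simp
  refine ContinuousLinearMap.opNorm_le_of_isSymmetric_of_net _ ?_ hN1 hN ha fun y hy => ?_
  · exact Matrix.isSymmetric_toEuclideanLin_iff.2 hMt
  · convert h y hy using 2
    have hy1 : ∑ j, y j ^ 2 = 1 := by
      rw [← EuclideanSpace.real_norm_sq_eq, hN1 y hy, one_pow]
    have e : inner ℝ (Matrix.toEuclideanLin M y) y = (y : κ → ℝ) ⬝ᵥ M.mulVec y := by
      rw [EuclideanSpace.inner_eq_star_dotProduct]
      simp [Matrix.toLpLin_apply]
    refine e.trans ?_
    rw [hM, Matrix.sub_mulVec, dotProduct_sub, Matrix.one_mulVec, ← Matrix.mulVec_mulVec,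
      Matrix.dotProduct_mulVec, Matrix.vecMul_transpose]
    congr 1
    · simp [dotProduct, sq]
    · rw [← hy1]
      simp [dotProduct, sq]

/-- The operator norm of `A` is controlled by the values of `‖Aᵀ u‖ ^ 2` on a net. -/
theorem norm_le_of_net {ι κ : Type*} [Fintype ι] [Fintype κ] [DecidableEq ι]
    [DecidableEq κ] (A : Matrix ι κ ℝ) {N : Finset (EuclideanSpace ℝ ι)}
    (hN : ∀ x : EuclideanSpace ℝ ι, ‖x‖ = 1 → ∃ y ∈ N, ‖x - y‖ ≤ 1 / 4) {a : ℝ} (ha : 0 ≤ a)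
    (h : ∀ u ∈ N, ∑ j, (A.transpose.mulVec u) j ^ 2 ≤ a ^ 2) : ‖A‖ ≤ 4 / 3 * a := by
  -- Passing to the transpose puts the net in the space indexed by the rows, whose dimension does
  -- not depend on the number of columns.
  rw [← Matrix.l2_opNorm_conjTranspose, Matrix.conjTranspose_eq_transpose_of_trivial,
    Matrix.l2_opNorm_def]
  refine ContinuousLinearMap.opNorm_le_of_net _ hN ha fun u hu => ?_
  refine le_of_sq_le_sq ?_ ha
  rw [EuclideanSpace.real_norm_sq_eq]
  exact h u hu

end Sketch

/-! ### Union bounds over the nets -/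

/-- The rational number `11 / 5` lies just above `log 9`; it lets net cardinalities enter the
exponents. -/
theorem nine_pow_le_exp (d : ℕ) : (9 : ℝ) ^ d ≤ Real.exp (11 / 5 * d) := by
  have h1 : (9 : ℝ) ≤ Real.exp (11 / 5) := by
    have h2 := Real.quadratic_le_exp_of_nonneg (x := 1 / 5) (by norm_num)
    have h3 := Real.exp_one_gt_d9
    have e : Real.exp (11 / 5) = Real.exp 1 ^ 2 * Real.exp (1 / 5) := by
      rw [← Real.exp_nat_mul, ← Real.exp_add]
      norm_num
    rw [e]
    calc (9 : ℝ) ≤ 2.718 ^ 2 * 1.22 := by norm_num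
      _ ≤ _ := by
        gcongr
        · linarith
        · linarith
  calc (9 : ℝ) ^ d ≤ Real.exp (11 / 5) ^ d := by gcongr
    _ = _ := by rw [← Real.exp_nat_mul, mul_comm]

/-- Union bound over a finite set of at most `9 ^ d` points. -/
theorem measure_biUnion_le_of_card_le_nine_pow {Ω E : Type*} [MeasurableSpace Ω] {P : Measure Ω}
    {N : Finset E} {d : ℕ} (hN : N.card ≤ 9 ^ d) {A : E → Set Ω} {c x : ℝ} (hc : 0 ≤ c)
    (h : ∀ y ∈ N, P (A y) ≤ ENNReal.ofReal (c * Real.exp x)) :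
    P (⋃ y ∈ N, A y) ≤ ENNReal.ofReal (c * Real.exp (11 / 5 * d + x)) := by
  refine (measure_biUnion_finset_le N A).trans ((Finset.sum_le_sum h).trans ?_)
  rw [Finset.sum_const, nsmul_eq_mul, ← ENNReal.ofReal_natCast, ← ENNReal.ofReal_mul (by simp)]
  refine ENNReal.ofReal_le_ofReal ?_
  have h1 : (N.card : ℝ) ≤ Real.exp (11 / 5 * d) :=
    le_trans (by exact_mod_cast hN) (nine_pow_le_exp d)
  calc (N.card : ℝ) * (c * Real.exp x) ≤ Real.exp (11 / 5 * d) * (c * Real.exp x) := by gcongr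
    _ = _ := by rw [Real.exp_add]; ring

namespace Sketch

variable {Ω : Type*} [MeasurableSpace Ω] {P : Measure Ω} [IsProbabilityMeasure P] {s n : ℕ}
  {S : Ω → Matrix (Fin s) (Fin n) ℝ} {ν : Measure ℝ} {p : ℝ}

open scoped Matrix.Norms.L2Operator

/-- A sub-Gaussian sketch is a near isometry on a fixed low-dimensional subspace. -/
theorem HasIIDEntries.measure_not_isometry_le (hs : 0 < s) (hp0 : 0 < p) (hp1 : p ≤ 1)
    (hS : HasIIDEntries P S ν) (hν : IsSubgaussianEntryLaw s p ν) {J : Type*} [Fintype J]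
    [DecidableEq J] {V : Matrix (Fin n) J ℝ} (hV : V.transpose * V = 1)
    (hJ : 82000 * (Fintype.card J : ℝ) ≤ s * p ^ 2) :
    P {ω | ¬ ‖(S ω * V).transpose * (S ω * V) - 1‖ ≤ 1 / 2} ≤
      ENNReal.ofReal (2 * Real.exp (-(s * (p ^ 2 / 36864)))) := by
  obtain ⟨N, hNc, hN1, hN⟩ := exists_sphere_net (EuclideanSpace ℝ J)
  rw [finrank_euclideanSpace] at hNc
  have hsub : {ω | ¬ ‖(S ω * V).transpose * (S ω * V) - 1‖ ≤ 1 / 2} ⊆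
      ⋃ y ∈ N, {ω | 1 / 4 ≤ |∑ i, (∑ j, S ω i j * (V.mulVec y) j) ^ 2 - 1|} := by
    intro ω hω
    by_contra hnot
    simp only [Set.mem_iUnion, Set.mem_ofPred_eq, not_exists, not_le] at hnot
    refine hω ?_
    have := norm_transpose_mul_self_sub_one_le (S ω * V) hN1 hN (a := 1 / 4) (by norm_num)
      fun y hy => by
        rw [← Matrix.mulVec_mulVec]
        exact (hnot y hy).le
    linarith
  refine (measure_mono hsub).trans ((measure_biUnion_le_of_card_le_nine_pow hNc zero_le_two
    fun y hy => hS.measure_sq_sub_one_le hs hp0 hp1 hν ?_).trans ?_)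
  · rw [sum_mulVec_sq hV, ← EuclideanSpace.real_norm_sq_eq, hN1 y hy, one_pow]
  -- Half of the exponent `s p ^ 2 / 18432` pays for the net: `11 / 5 * 36864 ≤ 82000`.
  · refine ENNReal.ofReal_le_ofReal (mul_le_mul_of_nonneg_left (Real.exp_le_exp.2 ?_) zero_le_two)
    linarith

/-- Operator norm bound for a sub-Gaussian sketch composed with a matrix with singular values
`√mⱼ ≤ √t` such that `∑ⱼ mⱼ ≤ s t`. -/
theorem HasIIDEntries.measure_not_norm_le (hs : 0 < s) (hp0 : 0 < p) (hp1 : p ≤ 1)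
    (hS : HasIIDEntries P S ν) (hν : IsSubgaussianEntryLaw s p ν) {J : Type*} [Fintype J]
    [DecidableEq J] {V : Matrix (Fin n) J ℝ} (hV : V.transpose * V = 1) {m : J → ℝ} {t : ℝ}
    (ht : 0 < t) (hm0 : ∀ j, 0 ≤ m j) (hm : ∀ j, m j ≤ t) (hsum : ∑ j, m j ≤ s * t) {c : ℝ}
    (hc : 22 / 5 / Real.sqrt p ≤ c) :
    P {ω | ¬ ‖S ω * V * Matrix.diagonal fun j => Real.sqrt (m j)‖ ≤ c * Real.sqrt t} ≤
      ENNReal.ofReal (Real.exp (-(s * (p ^ 2 / 36864)))) := by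
  obtain ⟨N, hNc, hN1, hN⟩ := exists_sphere_net (EuclideanSpace ℝ (Fin s))
  rw [finrank_euclideanSpace, Fintype.card_fin] at hNc
  have hc0 : 0 ≤ c := le_trans (by positivity) hc
  -- Here `19.36 = (22 / 5) ^ 2`, and the threshold `10.89` below is `(3 / 4) ^ 2 * 19.36`, where `3
  -- / 4` offsets the loss `4 / 3` of the net.
  have hcsq : 19.36 / p ≤ c ^ 2 := by
    have := pow_le_pow_left₀ (by positivity) hc 2
    rw [div_pow, Real.sq_sqrt hp0.le] at this
    refine le_trans (le_of_eq ?_) this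
    norm_num
  have hsub : {ω | ¬ ‖S ω * V * Matrix.diagonal fun j => Real.sqrt (m j)‖ ≤ c * Real.sqrt t} ⊆
      ⋃ u ∈ N, {ω | 10.89 * t / p ≤ ∑ j, m j * (∑ i, (S ω * V) i j * u i) ^ 2} := by
    intro ω hω
    by_contra hnot
    simp only [Set.mem_iUnion, Set.mem_ofPred_eq, not_exists, not_le] at hnot
    refine hω ?_
    have := norm_le_of_net (S ω * V * Matrix.diagonal fun j => Real.sqrt (m j)) hN
      (a := 3 / 4 * (c * Real.sqrt t)) (by positivity) fun u hu => by
        have e : ∑ j, ((S ω * V * Matrix.diagonal fun j => Real.sqrt (m j)).transpose.mulVec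
            u) j ^ 2 = ∑ j, m j * (∑ i, (S ω * V) i j * u i) ^ 2 := by
          refine Finset.sum_congr rfl fun j _ => ?_
          simp only [Matrix.mulVec, dotProduct, Matrix.transpose_apply, Matrix.mul_diagonal]
          rw [← Real.sq_sqrt (hm0 j), ← mul_pow, Finset.mul_sum, Real.sq_sqrt (hm0 j)]
          congr 1
          exact Finset.sum_congr rfl fun i _ => by ring
        rw [e]
        refine (hnot u hu).le.trans ?_
        rw [mul_pow, mul_pow, Real.sq_sqrt ht.le]
        calc 10.89 * t / p = 9 / 16 * (19.36 / p * t) := by ring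
          _ ≤ 9 / 16 * (c ^ 2 * t) := by gcongr
          _ = _ := by ring
    linarith
  refine (measure_mono hsub).trans ((measure_biUnion_le_of_card_le_nine_pow
    (x := s - s * 10.89 / 3) hNc zero_le_one fun u hu => ?_).trans ?_)
  · rw [one_mul]
    refine hS.measure_weighted_sq_le hs hp0 hν hV ht hm0 hm hsum ?_ 10.89
    rw [← EuclideanSpace.real_norm_sq_eq, hN1 u hu, one_pow]
  -- The net has up to `9 ^ s` points; the total exponent is `s (11 / 5 + 1 - 10.89 / 3) = -0.43 s`,
  -- with ample room since `p ≤ 1`.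
  · rw [one_mul]
    refine ENNReal.ofReal_le_ofReal (Real.exp_le_exp.2 ?_)
    have h1 : p ^ 2 ≤ 1 := pow_le_one₀ hp0.le hp1
    have h2 : (0 : ℝ) ≤ s := Nat.cast_nonneg s
    nlinarith [mul_le_mul_of_nonneg_left h1 h2]

/-- Since `exp 3 ≤ 25`, `√(log 5) ≥ 6 / 5`, and `2 (1 + 6 / 5) = 22 / 5`. The summand `1` is pure
slack. -/
theorem le_satisfiability_constant (hp0 : 0 < p) :
    22 / 5 / Real.sqrt p ≤ 2 / Real.sqrt p * (1 + Real.sqrt (Real.log 5)) + 1 := by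
  have h1 : 6 / 5 ≤ Real.sqrt (Real.log 5) := by
    refine Real.le_sqrt_of_sq_le ?_
    rw [Real.le_log_iff_exp_le (by norm_num)]
    have h2 : Real.exp ((6 / 5) ^ 2) ≤ Real.exp (3 / 2) := Real.exp_le_exp.2 (by norm_num)
    refine h2.trans (le_of_pow_le_pow_left₀ (n := 2) (by norm_num) (by norm_num) ?_)
    rw [← Real.exp_nat_mul, show ((2 : ℕ) : ℝ) * (3 / 2) = ((3 : ℕ) : ℝ) * 1 by norm_num,
      Real.exp_nat_mul]
    calc Real.exp 1 ^ 3 ≤ 2.72 ^ 3 := by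
          gcongr
          linarith [Real.exp_one_lt_d9]
      _ ≤ 5 ^ 2 := by norm_num
  calc 22 / 5 / Real.sqrt p = 2 / Real.sqrt p * (1 + 6 / 5) := by ring
    _ ≤ 2 / Real.sqrt p * (1 + Real.sqrt (Real.log 5)) := by gcongr
    _ ≤ _ := by linarith

theorem IsSparsifiedSketch.exists_entryLaw {Ω : Type*} [MeasurableSpace Ω] {P : Measure Ω}
    {s n : ℕ} {S : Ω → Matrix (Fin s) (Fin n) ℝ} {p : ℝ} (hs : 0 < s) (hp0 : 0 < p) (hp1 : p ≤ 1)
    (hS : IsSparsifiedSketch P p S) :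
    ∃ ν, HasIIDEntries P S ν ∧ IsSubgaussianEntryLaw s p ν := by
  rcases hS with h | h
  · exact ⟨_, h, isSubgaussianEntryLaw_rademacher hs hp0 hp1⟩
  · exact ⟨_, h, isSubgaussianEntryLaw_gaussian hs hp0 hp1⟩

/-- The tail of the spectrum is controlled by a sub-Gaussian sketch. -/
theorem HasIIDEntries.measure_not_tail_le (hn : 0 < n) (hs : 0 < s) (hp0 : 0 < p) (hp1 : p ≤ 1)
    (hS : HasIIDEntries P S ν) (hν : IsSubgaussianEntryLaw s p ν)
    {U : Matrix (Fin n) (Fin n) ℝ} (hU : U.transpose * U = 1) {μ : Fin n → ℝ} (hμ : Antitone μ)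
    (hμ0 : ∀ i, 0 ≤ μ i) (hr : criticalRadiusSq μ * n ≤ s) {c : ℝ}
    (hc : 22 / 5 / Real.sqrt p ≤ c) :
    P {ω | ¬ ‖S ω * rightBlock U μ * sqrtTail μ‖ ≤ c * criticalRadius μ} ≤
      ENNReal.ofReal (Real.exp (-(s * (p ^ 2 / 36864)))) := by
  have hle : ∀ j : {j : Fin n // statDim μ ≤ (j : ℕ)}, μ j ≤ criticalRadiusSq μ :=
    fun j => le_criticalRadiusSq_of_statDim_le hμ j.2
  rcases (criticalRadiusSq_nonneg μ).eq_or_lt with h0 | ht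
  · have hz : sqrtTail μ = 0 := by
      unfold sqrtTail
      rw [Matrix.diagonal_eq_zero]
      exact funext fun j => Real.sqrt_eq_zero'.2 ((hle j).trans h0.ge)
    simp [hz, criticalRadius, ← h0]
  · have hsum : ∑ j : {j : Fin n // statDim μ ≤ (j : ℕ)}, μ j ≤ s * criticalRadiusSq μ := by
      refine (sum_tail_le hn hμ hμ0).trans ?_
      rw [sq, ← mul_assoc, mul_comm (n : ℝ)]
      gcongr
    exact hS.measure_not_norm_le hs hp0 hp1 hν (V := rightBlock U μ)
      (m := fun j : {j : Fin n // statDim μ ≤ (j : ℕ)} => μ j)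
      (submatrix_transpose_mul_self hU _) ht (fun j => hμ0 j) hle hsum hc

end Sketch

/-! ### The main theorem -/

theorem theorem4 :
    ∃ (C₀ C₁ : ℝ) (κ : ℝ → ℝ), 0 < C₀ ∧ 0 < C₁ ∧
      (∀ p ∈ Set.Ioc (0 : ℝ) 1, 0 < κ p) ∧ StrictMonoOn κ (Set.Ioc (0 : ℝ) 1) ∧
      ∀ (n s : ℕ) (_hn : 0 < n) (p : ℝ) (_hp : p ∈ Set.Ioc (0 : ℝ) 1)
        (K : Matrix (Fin n) (Fin n) ℝ) (_hK : K.PosSemidef)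
        (U : Matrix (Fin n) (Fin n) ℝ) (μ : Fin n → ℝ)
        (_hU : Sketch.IsEigendecomposition K U μ)
        (Ω : Type*) [MeasurableSpace Ω] (P : MeasureTheory.Measure Ω)
        [MeasureTheory.IsProbabilityMeasure P]
        (S : Ω → Matrix (Fin s) (Fin n) ℝ) (_hS : Sketch.IsSparsifiedSketch P p S),
        max (C₀ * (Sketch.statDim μ : ℝ) / p ^ 2) (Sketch.criticalRadiusSq μ * (n : ℝ)) ≤ (s : ℝ) →
        1 - C₁ * Real.exp (-((s : ℝ) * κ p)) ≤
          P.real {ω | Sketch.KSatisfiable U μ (S ω)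
            (2 / Real.sqrt p * (1 + Real.sqrt (Real.log 5)) + 1)} := by
  -- The constant `3` adds the factor `2` of the two-sided isometry bound and the factor `1` of the
  -- tail bound.
  refine ⟨82000, 3, fun p => p ^ 2 / 36864, by norm_num, by norm_num,
    fun p hp => div_pos (pow_pos hp.1 2) (by norm_num), fun p hp q hq hpq =>
      div_lt_div_of_pos_right (pow_lt_pow_left₀ hpq hp.1.le two_ne_zero) (by norm_num), ?_⟩
  intro n s hn p hp K hK U μ hU Ω _ P _ S hS hmax
  obtain ⟨hp0, hp1⟩ := hp
  obtain ⟨hd, hr⟩ := max_le_iff.1 hmax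
  rw [div_le_iff₀ (by positivity)] at hd
  -- The sketch has at least one row because `dₙ ≥ 1`.
  have hs : 0 < s := by
    have hpos : (0 : ℝ) < Sketch.statDim μ := Nat.cast_pos.2 (Sketch.statDim_pos hn μ)
    have : (0 : ℝ) < s * p ^ 2 := by linarith
    exact Nat.cast_pos.1 (pos_of_mul_pos_left this (sq_nonneg p))
  obtain ⟨ν, hS, hν⟩ := hS.exists_entryLaw hs hp0 hp1
  set c := 2 / Real.sqrt p * (1 + Real.sqrt (Real.log 5)) + 1 with hc
  have hUU := hU.transpose_mul_self
  have hμ0 := hU.nonneg hK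
  have hleft := hS.measure_not_isometry_le hs hp0 hp1 hν
    (V := Sketch.leftBlock U μ) (Sketch.submatrix_transpose_mul_self hUU _) (by
      have : (Fintype.card {j : Fin n // (j : ℕ) < Sketch.statDim μ} : ℝ) ≤ Sketch.statDim μ :=
        Nat.cast_le.2 (Sketch.card_left_le μ)
      linarith)
  have hright := hS.measure_not_tail_le hn hs hp0 hp1 hν hUU hU.antitone hμ0 hr
    (Sketch.le_satisfiability_constant hp0)
  set G := {ω | Sketch.KSatisfiable U μ (S ω) c} with hG
  have hbad : P Gᶜ ≤ ENNReal.ofReal (3 * Real.exp (-(s * (p ^ 2 / 36864)))) := by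
    refine (measure_mono fun ω hω => not_and_or.1 hω).trans ((measure_union_le _ _).trans
      ((add_le_add hleft hright).trans_eq ?_))
    rw [← ENNReal.ofReal_add (by positivity) (by positivity)]
    congr 1
    ring
  have hbad' : P.real Gᶜ ≤ 3 * Real.exp (-(s * (p ^ 2 / 36864))) :=
    ENNReal.toReal_le_of_le_ofReal (by positivity) hbad
  -- Subadditivity suffices here, so no measurability of `G` is needed.
  have huniv : (1 : ℝ) ≤ P.real G + P.real Gᶜ := by
    rw [← probReal_univ (μ := P), ← Set.union_compl_self G]
    exact measureReal_union_le _ _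
  linarith
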